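/- Let $F$ be a field of characteristic $p>0$ with $p\neq 2$, let $n\ge 1$ be an integer not divisible by $p$, and let $R=M_n(F)$ be the associative algebra of $n\times n$ matrices over $F$. Denote by $R^{(-)}$ the Lie algebra with underlying vector space $R$ and bracket $[x,y]=xy-yx$. Let $G$ be a finite abelian $p$-group with identity element $1_G$. Suppose that $R=\bigoplus_{g\in G}R_g$ is a $G$-grading of the Lie algebra $R^{(-)}$, i.e. a direct sum decomposition into $F$-subspaces with $[R_g,R_h]\subseteq R_{gh}$ for all $g,h\in G$. Then the same decomposition is a $G$-grading of the associative algebra $R$ (i.e. $R_gR_h\subseteq R_{gh}$ for all $g,h\in G$) if and only if the identity matrix belongs to $R_{1_G}$. -/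

import Mathlib

/-- A grading by the group `G` of a (not necessarily associative, not necessarily unital)
`F`-algebra whose underlying vector space is `A` and whose product is `op`: a family of subspaces
`A_g` such that `A = ⨁_{g ∈ G} A_g` and `A_g A_h ⊆ A_{gh}`. -/
structure IsGroupGrading {F A G : Type*} [Semiring F] [AddCommMonoid A] [Module F A]
    [Group G] [DecidableEq G] (op : A → A → A) (𝒜 : G → Submodule F A) : Prop where
  isInternal : DirectSum.IsInternal 𝒜
  op_mem : ∀ (g h : G) (x y : A), x ∈ 𝒜 g → y ∈ 𝒜 h → op x y ∈ 𝒜 (g * h)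

/-- `G`-gradings of the algebra `R` (with respect to its own product). No condition on the unit
element is imposed. -/
def IsAlgebraGrading (F R : Type*) {G : Type*} [CommRing F] [Ring R] [Algebra F R]
    [Group G] [DecidableEq G] (𝒜 : G → Submodule F R) : Prop :=
  IsGroupGrading (fun x y : R => x * y) 𝒜

/-- `G`-gradings of the Lie algebra `R^(-)`: the vector space `R` with the commutator
`[x, y] = x y - y x` as its product. -/
def IsMinusLieGrading (F R : Type*) {G : Type*} [CommRing F] [Ring R] [Algebra F R]
    [Group G] [DecidableEq G] (𝒜 : G → Submodule F R) : Prop :=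
  IsGroupGrading (fun x y : R => x * y - y * x) 𝒜

/-! ### Casimir identities and cocycles of matrix algebras. -/

section Casimir

open Matrix

variable {F B N V : Type*} [Field F] [CommRing B] [Algebra F B] [Fintype N] [DecidableEq N]

/-! Encode the grading as a coaction `φ x = ∑ x_g ⊗ g` from `M_n(F)` to `M_n(F[G])`. The Lie grading
makes `φ` a Lie homomorphism; multiplicativity of `φ` gives an associative grading. As `G` is a
`p`-group, the augmentation ideal `I` is nilpotent, and `φ` is the inclusion modulo `I`. Let `J` be
generated by the entries of the defect `φ(xy) - φ(x)φ(y)`. Modulo `I * J` the defect is a Hochschild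
2-cocycle, symmetric because `φ` is Lie, and zero at the unit because `φ 1 = 1`. By
`Matrix.symmetric_cocycle_eq_zero` it vanishes, so `J ≤ I * J` and `J = 0`
(`Matrix.map_mul_of_lie_of_isNilpotent`). -/

theorem Matrix.sum_single_mul_mul_single (x : Matrix N N B) :
    ∑ i, ∑ j, single i j (1 : B) * x * single j i 1 = x.trace • (1 : Matrix N N B) := by
  ext a b
  simp [Matrix.sum_apply, Matrix.single_mul_mul_single, Matrix.single_apply, Matrix.trace,
    Matrix.one_apply, ite_and]

theorem Matrix.sum_single_mul_single :
    ∑ i, ∑ j, single i j (1 : B) * single j i 1 =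
      (Fintype.card N : Matrix N N B) := by
  have h := Matrix.sum_single_mul_mul_single (1 : Matrix N N B)
  simp only [mul_one, Matrix.trace_one] at h
  rw [h, ← Matrix.diagonal_natCast, ← Matrix.smul_one_eq_diagonal]

/-- The Casimir tensor `∑ Eᵢⱼ ⊗ Eⱼᵢ` may be multiplied from the left in either factor,
the other factor being multiplied from the right. -/
theorem Matrix.sum_casimir_left [AddCommGroup V] [Module F V]
    (f : Matrix N N F →ₗ[F] Matrix N N F →ₗ[F] V) (x : Matrix N N F) :
    ∑ i, ∑ j, f (single i j 1) (single j i 1 * x) =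
      ∑ i, ∑ j, f (x * single i j 1) (single j i 1) := by
  induction x using Matrix.induction_on' with
  | h_zero => simp
  | h_add p q hp hq => simp [mul_add, add_mul, Finset.sum_add_distrib, hp, hq]
  | h_std_basis k l a =>
    have h1 : ∀ i j, f (single i j 1) (single j i 1 * single k l a) =
        if i = k then f (single k j 1) (single j l a) else 0 := by
      intro i j
      split_ifs with h
      · subst h; simp
      · simp [Matrix.single_mul_single_of_ne, h]
    have h2 : ∀ i j, f (single k l a * single i j 1) (single j i 1) =
        if i = l then f (single k j a) (single j l 1) else 0 := by
      intro i j
      split_ifs with h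
      · subst h; simp
      · rw [Matrix.single_mul_single_of_ne (h := fun e => h e.symm)]; simp
    simp only [h1, h2]
    rw [Finset.sum_comm]
    conv_rhs => rw [Finset.sum_comm]
    simp only [Finset.sum_ite_eq', Finset.mem_univ, if_true]
    refine Finset.sum_congr rfl fun j _ => ?_
    have e1 : single j l a = a • single j l (1 : F) := by simp [Matrix.smul_single]
    have e2 : single k j a = a • single k j (1 : F) := by simp [Matrix.smul_single]
    rw [e1, e2, map_smul, map_smul, LinearMap.smul_apply]

theorem Matrix.sum_casimir_right [AddCommGroup V] [Module F V]
    (f : Matrix N N F →ₗ[F] Matrix N N F →ₗ[F] V) (x : Matrix N N F) :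
    ∑ i, ∑ j, f (single i j 1) (x * single j i 1) =
      ∑ i, ∑ j, f (single i j 1 * x) (single j i 1) := by
  have h := Matrix.sum_casimir_left f.flip x
  simp only [LinearMap.flip_apply] at h
  rw [Finset.sum_comm, ← h, Finset.sum_comm]

theorem Matrix.sum_casimir_lie [AddCommGroup V] [Module F V]
    (f : Matrix N N F →ₗ[F] Matrix N N F →ₗ[F] V) (x : Matrix N N F) :
    ∑ i, ∑ j, f (single i j 1) (single j i 1 * x - x * single j i 1) =
      ∑ i, ∑ j, f (x * single i j 1 - single i j 1 * x) (single j i 1) := by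
  simp only [map_sub, LinearMap.sub_apply, Finset.sum_sub_distrib, Matrix.sum_casimir_left,
    Matrix.sum_casimir_right]

/-- The Casimir element acts on the adjoint representation of `gl_n` by `m ↦ 2 n m - 2 tr m`. -/
theorem Matrix.sum_single_lie_lie (m : Matrix N N B) :
    ∑ i, ∑ j, (single i j (1 : B) * (single j i 1 * m - m * single j i 1) -
      (single j i 1 * m - m * single j i 1) * single i j 1) =
      (2 * Fintype.card N : B) • m - (2 * m.trace) • (1 : Matrix N N B) := by
  have h : ∀ i j, (single i j (1 : B) * (single j i 1 * m - m * single j i 1) -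
      (single j i 1 * m - m * single j i 1) * single i j 1) =
      (single i j 1 * single j i 1) * m - single i j 1 * m * single j i 1 -
      single j i 1 * m * single i j 1 + m * (single j i 1 * single i j 1) := by
    intro i j; noncomm_ring
  simp only [h, Finset.sum_add_distrib, Finset.sum_sub_distrib]
  rw [Finset.sum_comm (f := fun i j => single j i (1 : B) * m * single i j 1),
    Finset.sum_comm (f := fun i j => m * (single j i (1 : B) * single i j 1))]
  simp only [← Finset.sum_mul, ← Finset.mul_sum, Matrix.sum_single_mul_mul_single,
    Matrix.sum_single_mul_single]
  have hc : (Fintype.card N : Matrix N N B) = (Fintype.card N : B) • 1 := by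
    rw [← Matrix.diagonal_natCast, ← Matrix.smul_one_eq_diagonal]
  rw [hc]
  simp only [smul_mul_assoc, one_mul, mul_smul_comm, mul_one, two_mul, add_smul]
  abel

/-- A Lie derivation of `M_n` is inner up to a central summand, after multiplication by `2 n`. -/
theorem Matrix.lie_derivation_eq (ψ : Matrix N N F →ₗ[F] Matrix N N B)
    (hψ : ∀ x y, ψ (x * y - y * x) =
      (algebraMap F B).mapMatrix x * ψ y - ψ y * (algebraMap F B).mapMatrix x +
      (ψ x * (algebraMap F B).mapMatrix y - (algebraMap F B).mapMatrix y * ψ x)) :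
    ∃ u : Matrix N N B, ∀ x, (2 * Fintype.card N : B) • ψ x =
      ((algebraMap F B).mapMatrix x * u - u * (algebraMap F B).mapMatrix x) +
      (2 * (ψ x).trace) • (1 : Matrix N N B) := by
  set ι := (algebraMap F B).mapMatrix (m := N) with hι
  have hE : ∀ i j, ι (single i j 1) = single i j 1 := by
    intro i j; simp [hι, RingHom.mapMatrix_apply]
  -- Whitehead's argument: bracket `ψ` against the Casimir tensor, whose invariance (`h1`) makes the
  -- cross terms cancel.
  refine ⟨∑ i, ∑ j, (single i j (1 : B) * ψ (single j i 1) - ψ (single j i 1) * single i j 1),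
    fun x => ?_⟩
  let L : Matrix N N F →ₗ[F] Matrix N N B := (Algebra.ofId F B).mapMatrix.toLinearMap
  let f : Matrix N N F →ₗ[F] Matrix N N F →ₗ[F] Matrix N N B :=
    (LinearMap.mul F (Matrix N N B) - (LinearMap.mul F (Matrix N N B)).flip).compl₁₂ L ψ
  have hf : ∀ x y, f x y = ι x * ψ y - ψ y * ι x := fun x y => rfl
  have h1 := Matrix.sum_casimir_lie f x
  have h2 := Matrix.sum_single_lie_lie (ψ x)
  rw [← sub_eq_iff_eq_add, ← h2]
  simp only [hf, map_sub ι, map_mul ι, hE] at h1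
  have h3 : ∀ i j, single j i (1 : B) * ψ x - ψ x * single j i 1 =
      ψ (single j i 1 * x - x * single j i 1) -
        (ψ (single j i 1) * ι x - ι x * ψ (single j i 1)) := by
    intro i j; rw [hψ, hE]; abel
  simp only [h3, mul_sub (single _ _ (1 : B)) (ψ (_ - _)), sub_mul (ψ (_ - _))]
  have h4 : ∀ i j, single i j (1 : B) * ψ (single j i 1 * x - x * single j i 1) -
        single i j 1 * (ψ (single j i 1) * ι x - ι x * ψ (single j i 1)) -
        (ψ (single j i 1 * x - x * single j i 1) * single i j 1 -
          (ψ (single j i 1) * ι x - ι x * ψ (single j i 1)) * single i j 1) =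
      (single i j (1 : B) * ψ (single j i 1 * x - x * single j i 1) -
        ψ (single j i 1 * x - x * single j i 1) * single i j 1) -
      (single i j 1 * (ψ (single j i 1) * ι x - ι x * ψ (single j i 1)) -
          (ψ (single j i 1) * ι x - ι x * ψ (single j i 1)) * single i j 1) := by
    intro i j; abel
  simp only [h4]
  simp only [Finset.sum_sub_distrib (f := fun _ => _ - _)] 
  simp only [Finset.mul_sum, Finset.sum_mul, ← Finset.sum_sub_distrib] at h1 ⊢
  simp only [Finset.sum_sub_distrib] at h1 ⊢
  simp only [mul_sub, sub_mul, Finset.sum_sub_distrib, mul_assoc] at h1 ⊢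
  rw [sub_eq_iff_eq_add] at h1
  rw [sub_eq_iff_eq_add]
  rw [h1]
  abel

/-- A symmetric Hochschild 2-cocycle of `M_n` vanishing at the unit is zero if `2 n` is
invertible. -/
theorem Matrix.symmetric_cocycle_eq_zero (h2 : (2 : F) ≠ 0) (hN : (Fintype.card N : F) ≠ 0)
    (c : Matrix N N F →ₗ[F] Matrix N N F →ₗ[F] Matrix N N B)
    (hsymm : ∀ x y, c x y = c y x) (hone : ∀ x, c 1 x = 0)
    (hcoc : ∀ x y z, c (x * y) z + c x y * (algebraMap F B).mapMatrix z =
      c x (y * z) + (algebraMap F B).mapMatrix x * c y z) :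
    c = 0 := by
  set ι := (algebraMap F B).mapMatrix (m := N) with hι
  have hE : ∀ i j, ι (single i j 1) = single i j 1 := by
    intro i j; simp [hι, RingHom.mapMatrix_apply]
  let L : Matrix N N F →ₗ[F] Matrix N N B := (Algebra.ofId F B).mapMatrix.toLinearMap
  -- Contracting `c` with the separability tensor shows that `n c` is the coboundary of `ψ`.
  let ψ : Matrix N N F →ₗ[F] Matrix N N B :=
    ∑ i, ∑ j, (LinearMap.mulLeft F (single i j (1 : B))) ∘ₗ c (single j i 1)
  have hψ : ∀ x, ψ x = ∑ i, ∑ j, single i j (1 : B) * c (single j i 1) x := by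
    intro x; simp [ψ, LinearMap.sum_apply]
  have hd : ∀ y z, (Fintype.card N : B) • c y z = ι y * ψ z - ψ (y * z) + ψ y * ι z := by
    intro y z
    let f : Matrix N N F →ₗ[F] Matrix N N F →ₗ[F] Matrix N N B :=
      (LinearMap.mul F (Matrix N N B)).compl₁₂ L (c.flip z)
    have hf : ∀ a b, f a b = ι a * c b z := fun a b => rfl
    have h1 := Matrix.sum_casimir_left f y
    simp only [hf, map_mul ι, hE] at h1
    have h3 : (Fintype.card N : B) • c y z =
        ∑ i, ∑ j, single i j (1 : B) * (single j i 1 * c y z) := by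
      simp only [← mul_assoc, ← Finset.sum_mul, Matrix.sum_single_mul_single]
      rw [← Matrix.diagonal_natCast, ← Matrix.smul_one_eq_diagonal, smul_mul_assoc, one_mul]
    have h4 : ∀ i j, single j i (1 : B) * c y z =
        c (single j i 1 * y) z + c (single j i 1) y * ι z - c (single j i 1) (y * z) := by
      intro i j; rw [hcoc, hE]; abel
    rw [h3]
    simp only [h4, hψ, mul_add, mul_sub, Finset.sum_add_distrib, Finset.sum_sub_distrib,
      h1, Finset.mul_sum, Finset.sum_mul, mul_assoc]
    abel
  -- Symmetry of `c` equates the two coboundary formulas, so `ψ` is a Lie derivation.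
  have hlie : ∀ x y, ψ (x * y - y * x) =
      ι x * ψ y - ψ y * ι x + (ψ x * ι y - ι y * ψ x) := by
    intro x y
    have h := hd x y
    rw [hsymm, hd y x] at h
    rw [map_sub, sub_eq_iff_eq_add, ← sub_eq_zero]
    rw [← sub_eq_zero] at h
    rw [← h]; abel
  obtain ⟨u, hu⟩ := Matrix.lie_derivation_eq ψ hlie
  let θ : Matrix N N F →ₗ[F] B := Matrix.traceLinearMap N F B ∘ₗ ψ
  have hθ : ∀ x, θ x = (ψ x).trace := fun x => rfl
  have hθc : ∀ x y, θ (x * y) = θ (y * x) := by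
    intro x y
    rw [← sub_eq_zero, ← map_sub, hθ, hlie]
    simp only [Matrix.trace_add, Matrix.trace_sub, Matrix.trace_mul_comm (ι x),
      Matrix.trace_mul_comm (ι y), sub_self, add_zero]
  -- The inner part of `2 n ψ` is a derivation and drops out; only the trace part survives.
  have key : ∀ y z, (2 * Fintype.card N * Fintype.card N : B) • c y z =
      (2 * θ z) • ι y - (2 * θ (y * z)) • 1 + (2 * θ y) • ι z := by
    intro y z
    rw [mul_smul, hd, smul_add, smul_sub, ← mul_smul_comm, ← smul_mul_assoc, hu, hu, hu]
    simp only [hθ, map_mul, mul_add, add_mul, mul_smul_comm, smul_mul_assoc, mul_one, one_mul]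
    noncomm_ring
  have hunit2 : IsUnit (2 : B) := by
    simpa only [map_ofNat] using (IsUnit.mk0 _ h2).map (algebraMap F B)
  have hunitN : IsUnit (Fintype.card N : B) := by
    simpa using (IsUnit.mk0 _ hN).map (algebraMap F B)
  have hθ1 : θ 1 = 0 := by
    have h := key 1 1
    rw [hone, smul_zero] at h
    have hne : Nonempty N := by
      by_contra hne
      rw [not_nonempty_iff] at hne
      simp at hN
    obtain ⟨i⟩ := hne
    have := congrFun (congrFun h i) i
    simp [hι, RingHom.mapMatrix_apply] at this
    exact (hunit2.mul_right_eq_zero).1 this.symm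
  -- A functional killing commutators satisfies `n θ(z) = tr(z) θ(1)`.
  have hθ0 : ∀ z, θ z = 0 := by
    intro z
    have h := congrArg θ (Matrix.sum_single_mul_mul_single z)
    have h' := congrArg (fun m => θ (z * m)) (Matrix.sum_single_mul_single (B := F) (N := N))
    simp only [Finset.mul_sum, map_sum, map_smul, hθ1, smul_zero] at h h'
    rw [Finset.sum_comm] at h'
    have e : ∀ i j, θ (single i j 1 * z * single j i 1) =
        θ (z * (single j i 1 * single i j 1)) := by
      intro i j; rw [mul_assoc, hθc, mul_assoc]
    simp only [e] at h
    rw [h, ← Matrix.diagonal_natCast, ← Matrix.smul_one_eq_diagonal, mul_smul_comm, mul_one,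
      map_smul] at h'
    exact (smul_eq_zero_iff_right hN).1 h'.symm
  ext1 y
  ext1 z
  have h := key y z
  simp only [hθ0, mul_zero, zero_smul, sub_zero, add_zero] at h
  exact ((hunit2.mul hunitN).mul hunitN).smul_eq_zero.1 h

end Casimir

/-! ### Lifting multiplicativity along a nilpotent ideal. -/

section Lifting

variable {F A N : Type*} [Field F] [CommRing A] [Algebra F A] [Fintype N] [DecidableEq N]

theorem Ideal.eq_bot_of_le_mul_of_isNilpotent {I J : Ideal A} (hI : IsNilpotent I)
    (h : J ≤ I * J) : J = ⊥ := by
  have hk : ∀ k : ℕ, J ≤ I ^ k * J := by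
    intro k
    induction k with
    | zero => simp
    | succ k ih =>
      rw [pow_succ', mul_assoc]
      exact h.trans (Ideal.mul_mono_right ih)
  obtain ⟨k, h0⟩ := hI
  simpa [h0] using hk k

/-- A unital Lie homomorphism `M_n(F) → M_n(A)` which is the inclusion modulo a nilpotent ideal
is multiplicative, if `2 n` is invertible. -/
theorem Matrix.map_mul_of_lie_of_isNilpotent (h2 : (2 : F) ≠ 0)
    (hN : (Fintype.card N : F) ≠ 0) {I : Ideal A} (hI : IsNilpotent I)
    (φ : Matrix N N F →ₗ[F] Matrix N N A) (hone : φ 1 = 1)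
    (hlie : ∀ x y, φ (x * y - y * x) = φ x * φ y - φ y * φ x)
    (hφ : ∀ x i j, φ x i j - algebraMap F A (x i j) ∈ I) (x y : Matrix N N F) :
    φ (x * y) = φ x * φ y := by
  let d : Matrix N N F →ₗ[F] Matrix N N F →ₗ[F] Matrix N N A :=
    (LinearMap.mul F (Matrix N N F)).compr₂ φ - (LinearMap.mul F (Matrix N N A)).compl₁₂ φ φ
  have hd : ∀ x y, d x y = φ (x * y) - φ x * φ y := fun x y => rfl
  let J : Ideal A := Ideal.span {a | ∃ x y i j, d x y i j = a}
  have hJ : ∀ x y i j, d x y i j ∈ J := fun x y i j => Ideal.subset_span ⟨x, y, i, j, rfl⟩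
  let q : Matrix N N A →ₐ[F] Matrix N N (A ⧸ I * J) := (Ideal.Quotient.mkₐ F (I * J)).mapMatrix
  have hq : ∀ m i j, q m i j = Ideal.Quotient.mk (I * J) (m i j) := fun m i j => rfl
  have hq0 : ∀ m, (∀ i j, m i j ∈ I * J) → q m = 0 := by
    intro m hm
    ext i j
    exact Ideal.Quotient.eq_zero_iff_mem.2 (hm i j)
  -- Entries of `φ x - x` lie in `I` and those of `d y z` in `J`.
  have hq_left : ∀ x y z, q (φ x * d y z) =
      (algebraMap F (A ⧸ I * J)).mapMatrix x * q (d y z) := by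
    intro x y z
    have e : (algebraMap F (A ⧸ I * J)).mapMatrix x = q ((algebraMap F A).mapMatrix x) := rfl
    rw [e, ← map_mul, ← sub_eq_zero, ← map_sub, ← sub_mul]
    refine hq0 _ fun i j => ?_
    rw [Matrix.mul_apply]
    exact Ideal.sum_mem _ fun k _ => Ideal.mul_mem_mul (hφ x i k) (hJ y z k j)
  have hq_right : ∀ x y z, q (d y z * φ x) =
      q (d y z) * (algebraMap F (A ⧸ I * J)).mapMatrix x := by
    intro x y z
    have e : (algebraMap F (A ⧸ I * J)).mapMatrix x = q ((algebraMap F A).mapMatrix x) := rfl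
    rw [e, ← map_mul, ← sub_eq_zero, ← map_sub, ← mul_sub]
    refine hq0 _ fun i j => ?_
    rw [Matrix.mul_apply]
    refine Ideal.sum_mem _ fun k _ => ?_
    rw [mul_comm I]
    exact Ideal.mul_mem_mul (hJ y z i k) (hφ x k j)
  have hc : d.compr₂ q.toLinearMap = 0 := by
    refine Matrix.symmetric_cocycle_eq_zero h2 hN _ (fun x y => ?_) (fun x => ?_)
      (fun x y z => ?_)
    · refine congrArg q ?_
      have h := hlie x y
      rw [map_sub, sub_eq_sub_iff_sub_eq_sub] at h
      exact h
    · change q (d 1 x) = 0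
      simp [hd, hone]
    · change q (d (x * y) z) + q (d x y) * _ = q (d x (y * z)) + _ * q (d y z)
      rw [← hq_left, ← hq_right, ← map_add, ← map_add]
      refine congrArg q ?_
      simp only [hd]
      noncomm_ring
  have hJI : J ≤ I * J := by
    refine Ideal.span_le.2 ?_
    rintro a ⟨x, y, i, j, rfl⟩
    have h := congrFun (congrFun (LinearMap.congr_fun (LinearMap.congr_fun hc x) y) i) j
    exact Ideal.Quotient.eq_zero_iff_mem.1 h
  have hJ0 := Ideal.eq_bot_of_le_mul_of_isNilpotent hI hJI
  rw [← sub_eq_zero, ← hd]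
  ext i j
  have h := hJ x y i j
  rw [hJ0] at h
  exact h

end Lifting

/-! ### Gradings as coactions of the group algebra. -/

section Grading

theorem Matrix.map_single_mul_map_single {F G N : Type*} [Semiring F] [Monoid G]
    [Fintype N] (g h : G) (x y : Matrix N N F) :
    x.map (MonoidAlgebra.single g) * y.map (MonoidAlgebra.single h) =
      (x * y).map (MonoidAlgebra.single (g * h)) := by
  ext1 i j
  simp only [Matrix.mul_apply, Matrix.map_apply, MonoidAlgebra.single_mul_single]
  exact (map_sum (MonoidAlgebra.singleAddHom (g * h)) _ _).symm

/-- The augmentation ideal of the group algebra of a finite abelian `p`-group in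
characteristic `p` is nilpotent. -/
theorem MonoidAlgebra.isNilpotent_ker_lift_one {F G : Type*} [Field F] (p : ℕ) [Fact p.Prime]
    [CharP F p] [CommGroup G] [Finite G] (hG : IsPGroup p G) :
    IsNilpotent (RingHom.ker (MonoidAlgebra.lift F F G (1 : G →* F))) := by
  have : Module.Finite F (MonoidAlgebra F G) := .of_basis (MonoidAlgebra.basis G F)
  have : IsNoetherianRing (MonoidAlgebra F G) := IsNoetherianRing.of_finite F _
  refine (Ideal.FG.isNilpotent_iff_le_nilradical (IsNoetherian.noetherian _)).2 fun a ha => ?_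
  obtain ⟨k, hk⟩ := IsPGroup.iff_card.1 hG
  have : CharP (MonoidAlgebra F G) p := charP_of_injective_algebraMap
    (algebraMap F (MonoidAlgebra F G)).injective p
  refine ⟨p ^ k, ?_⟩
  -- Here `p ^ k` is the order of `G`, so this iterate of Frobenius sends every group element to
  -- `1`.
  have key : ∀ b : MonoidAlgebra F G,
      b ^ p ^ k = algebraMap F _ (MonoidAlgebra.lift F F G (1 : G →* F) b ^ p ^ k) := by
    intro b
    induction b using MonoidAlgebra.induction_linear with
    | zero => simp [(Fact.out : p.Prime).ne_zero]
    | add f g hf hg => rw [add_pow_char_pow, hf, hg, map_add, add_pow_char_pow, map_add]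
    | single g r =>
      rw [MonoidAlgebra.single_pow, ← hk, pow_card_eq_one']
      simp [MonoidAlgebra.lift_single]
  rw [key, (RingHom.mem_ker).1 ha]
  simp [(Fact.out : p.Prime).ne_zero]

/-- Comparing components of degree `g` in `a * 1 = a`, for `a` homogeneous of degree `g`, shows that
the identity component of `1` is a right unit, hence equals `1`. -/
theorem IsGroupGrading.one_mem {F R G : Type*} [CommRing F] [Ring R] [Algebra F R] [Group G]
    [DecidableEq G] {𝒜 : G → Submodule F R} (h : IsAlgebraGrading F R 𝒜) : (1 : R) ∈ 𝒜 1 := by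
  let : DirectSum.Decomposition 𝒜 := h.isInternal.chooseDecomposition
  set e : R := (DirectSum.decompose 𝒜 (1 : R) 1 : R) with he
  have hx : ∀ x : R, x * e = x := by
    intro x
    induction x using DirectSum.Decomposition.inductionOn 𝒜 with
    | zero => simp
    | add a b ha hb => rw [add_mul, ha, hb]
    | @homogeneous g a =>
      have hm : ∀ b : R, (DirectSum.decompose 𝒜 ((a : R) * b) g : R) =
          a * (DirectSum.decompose 𝒜 b 1 : R) := by
        intro b
        induction b using DirectSum.Decomposition.inductionOn 𝒜 with
        | zero => simp
        | add b c hb hc =>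
          simp only [mul_add, DirectSum.decompose_add, DirectSum.add_apply, Submodule.coe_add,
            hb, hc]
        | @homogeneous k b =>
          have hab := h.op_mem g k a b a.2 b.2
          by_cases hk : k = 1
          · subst hk
            rw [mul_one] at hab
            rw [DirectSum.decompose_of_mem_same 𝒜 hab, DirectSum.decompose_of_mem_same 𝒜 b.2]
          · rw [DirectSum.decompose_of_mem_ne 𝒜 hab (by simpa using hk),
              DirectSum.decompose_of_mem_ne 𝒜 b.2 hk, mul_zero]
      have h1 := hm 1
      rw [mul_one, DirectSum.decompose_of_mem_same 𝒜 a.2] at h1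
      exact h1.symm
  have h1 := hx 1
  rw [one_mul] at h1
  rw [← h1]
  exact SetLike.coe_mem _

/-- The coaction `x ↦ ∑ x_g ⊗ g` of the group algebra attached to a decomposition of a space of
matrices, with values in matrices over the group algebra. -/
noncomputable def Matrix.gradingCoaction {F G N : Type*} [Field F] [Fintype G] [DecidableEq G]
    (𝒜 : G → Submodule F (Matrix N N F)) [DirectSum.Decomposition 𝒜] :
    Matrix N N F →ₗ[F] Matrix N N (MonoidAlgebra F G) where
  toFun x := Matrix.of fun i j =>
    ∑ g, MonoidAlgebra.single g ((DirectSum.decompose 𝒜 x g : Matrix N N F) i j)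
  map_add' x y := by
    ext1 i j
    simp [MonoidAlgebra.single_add, Finset.sum_add_distrib]
  map_smul' r x := by
    ext1 i j
    simp [DirectSum.decompose_smul, DirectSum.smul_apply, Finset.smul_sum, MonoidAlgebra.smul_single]

variable {F G N : Type*} [Field F] [Fintype G] [DecidableEq G]
    (𝒜 : G → Submodule F (Matrix N N F)) [DirectSum.Decomposition 𝒜]

theorem Matrix.gradingCoaction_apply (x : Matrix N N F) (i j : N) :
    Matrix.gradingCoaction 𝒜 x i j =
      ∑ g, MonoidAlgebra.single g ((DirectSum.decompose 𝒜 x g : Matrix N N F) i j) := rfl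

theorem Matrix.gradingCoaction_of_mem {g : G} {x : Matrix N N F} (hx : x ∈ 𝒜 g) :
    Matrix.gradingCoaction 𝒜 x = x.map (MonoidAlgebra.single g) := by
  ext1 i j
  rw [Matrix.gradingCoaction_apply, Finset.sum_eq_single g]
  · rw [DirectSum.decompose_of_mem_same 𝒜 hx]; rfl
  · intro k _ hk
    rw [DirectSum.decompose_of_mem_ne 𝒜 hx hk.symm]; simp
  · simp

theorem Matrix.mem_of_gradingCoaction_eq {g : G} {x : Matrix N N F}
    (hx : Matrix.gradingCoaction 𝒜 x = x.map (MonoidAlgebra.single g)) : x ∈ 𝒜 g := by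
  have h : (DirectSum.decompose 𝒜 x g : Matrix N N F) = x := by
    ext i j
    have h := congrArg (fun a : MonoidAlgebra F G => a.coeff g) (congrFun (congrFun hx i) j)
    rw [Matrix.gradingCoaction_apply] at h
    simpa [Finsupp.single_apply] using h
  rw [← h]
  exact SetLike.coe_mem _

end Grading

theorem mainTheorem3 {F G : Type*} [Field F] (p : ℕ) [Fact p.Prime] [CharP F p] (hp2 : p ≠ 2)
    (n : ℕ) (hpn : ¬ p ∣ n) [CommGroup G] [Finite G] [DecidableEq G] (hG : IsPGroup p G)
    (𝓡 : G → Submodule F (Matrix (Fin n) (Fin n) F))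
    (h𝓡 : IsMinusLieGrading F (Matrix (Fin n) (Fin n) F) 𝓡) :
    IsAlgebraGrading F (Matrix (Fin n) (Fin n) F) 𝓡 ↔
      (1 : Matrix (Fin n) (Fin n) F) ∈ 𝓡 1 := by
  refine ⟨IsGroupGrading.one_mem, fun hone => ⟨h𝓡.isInternal, fun g h x y hx hy => ?_⟩⟩
  have := Fintype.ofFinite G
  let : DirectSum.Decomposition 𝓡 := h𝓡.isInternal.chooseDecomposition
  refine Matrix.mem_of_gradingCoaction_eq 𝓡 ?_
  have h2 : (2 : F) ≠ 0 := Ring.two_ne_zero (by rwa [ringChar.eq F p])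
  have hN : (Fintype.card (Fin n) : F) ≠ 0 := by
    rwa [Fintype.card_fin, Ne, CharP.cast_eq_zero_iff F p]
  rw [Matrix.map_mul_of_lie_of_isNilpotent h2 hN
    (MonoidAlgebra.isNilpotent_ker_lift_one (F := F) p hG) (Matrix.gradingCoaction 𝓡),
    Matrix.gradingCoaction_of_mem 𝓡 hx, Matrix.gradingCoaction_of_mem 𝓡 hy,
    Matrix.map_single_mul_map_single]
  · rw [Matrix.gradingCoaction_of_mem 𝓡 hone]
    ext1 i j
    by_cases hij : i = j
    · subst hij; simp [MonoidAlgebra.one_def]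
    · simp [hij]
  · intro x y
    induction x using DirectSum.Decomposition.inductionOn 𝓡 with
    | zero => simp
    | add a b ha hb =>
      have e : (a + b) * y - y * (a + b) = (a * y - y * a) + (b * y - y * b) := by noncomm_ring
      rw [e, map_add, map_add, ha, hb]; noncomm_ring
    | @homogeneous g a =>
      induction y using DirectSum.Decomposition.inductionOn 𝓡 with
      | zero => simp
      | add b c hb hc =>
        have e : (a : Matrix (Fin n) (Fin n) F) * (b + c) - (b + c) * a =
          (a * b - b * a) + (a * c - c * a) := by noncomm_ring
        rw [e, map_add, map_add, hb, hc]; noncomm_ring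
      | @homogeneous k b =>
        -- Commutativity of `G` puts both products of the commutator in the same degree.
        rw [Matrix.gradingCoaction_of_mem 𝓡 (h𝓡.op_mem g k a b a.2 b.2),
          Matrix.gradingCoaction_of_mem 𝓡 a.2, Matrix.gradingCoaction_of_mem 𝓡 b.2,
          Matrix.map_single_mul_map_single, Matrix.map_single_mul_map_single, mul_comm k g]
        exact Matrix.map_sub _ (fun r s => map_sub (MonoidAlgebra.singleAddHom (R := F) (g * k)) r s) _ _
  · intro x i j
    rw [RingHom.mem_ker, map_sub, AlgHom.commutes, sub_eq_zero]
    induction x using DirectSum.Decomposition.inductionOn 𝓡 with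
    | zero => simp
    | add a b ha hb => rw [map_add, Matrix.add_apply, map_add, ha, hb, ← map_add]; rfl
    | @homogeneous g a =>
      rw [Matrix.gradingCoaction_of_mem 𝓡 a.2]
      simp [MonoidAlgebra.lift_single]
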